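/- Let $G$ be a connected finite simple graph with $n$ vertices. Let $\sigma_3$ be the minimum of $d(x)+d(y)+d(z)$ over all independent sets $\{x,y,z\}$ of three vertices of $G$, where $\sigma_3=+\infty$ if $G$ has no such set. Let $k\ge 2$ be an integer. If $\sigma_3\ge n-2k+4$, then $G$ has a dominating $k$-ended tree, that is, a subgraph $T$ of $G$ that is a tree with at most $k$ leaves (vertices of degree one in $T$) such that the set $V(G)\setminus V(T)$ is independent in $G$. -/

import Mathlib

namespace SimpleGraph

/-- The parameter `σ_m` of a finite graph: the minimum of the degree sums of the independent sets
of `m` vertices, with value `⊤` (that is, `+∞`) if there is no independent set of `m` vertices. -/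
noncomputable def minDegreeSum {V : Type*} [Fintype V] (G : SimpleGraph V) [DecidableRel G.Adj]
    (m : ℕ) : ℕ∞ :=
  ⨅ (S : Finset V) (_ : G.IsNIndepSet m S), ((∑ v ∈ S, G.degree v : ℕ) : ℕ∞)

namespace Subgraph

variable {V : Type*} {G : SimpleGraph V}

/-- The set of end-vertices of a subgraph: its vertices with exactly one neighbour in it. -/
def endVerts (T : G.Subgraph) : Set V :=
  {v | v ∈ T.verts ∧ (T.neighborSet v).encard = 1}

/-- A subgraph is a `k`-ended tree if it is a tree with at most `k` end-vertices. -/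
def IsKEndedTree (T : G.Subgraph) (k : ℕ) : Prop :=
  T.coe.IsTree ∧ T.endVerts.encard ≤ k

/-- A subgraph `T` of `G` is dominating if the vertices of `G` outside `T` are pairwise
nonadjacent in `G`. -/
def IsDominating (T : G.Subgraph) : Prop :=
  G.IsIndepSet T.vertsᶜ

end Subgraph

end SimpleGraph

/-! Take a longest path `l` with ends `x` and `y`. If it misses an edge, connectedness gives a
missed edge `ab` with `a` attached to `l`. Follow a path from `a` outside `l` that cannot be
prolonged; it contains a vertex `q` with all neighbors on `l` or on that path. Then `x`, `y`, `q`
are independent. Maximality of `l` makes the predecessors of neighbors of `x`, the successors of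
neighbors of `y` and the neighbors of `q` on `l` pairwise disjoint
(`degree_add_degree_add_card_le`), so the degree sum is less than the number of vertices on the two
paths together.

By the hypothesis on `σ₃`, at most `2k - 5` vertices remain. The two paths form a tree with at most
three ends. Attaching a missed edge uses two vertices and costs at most one end, so `k - 3` such
rounds leave at most one vertex (`HasTreeOn.exists_isDominating`). -/

namespace SimpleGraph

variable {V : Type*} {G : SimpleGraph V}

/-! ### Growing trees by pendant edges and paths -/

namespace Subgraph

/-- The vertex `v` is isolated in `T.spanningCoe`, so the new edge closes no cycle. -/
theorem isAcyclic_spanningCoe_sup_pendant {T : G.Subgraph} (hT : T.spanningCoe.IsAcyclic) {t v : V}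
    (hv : v ∉ T.verts) (h : G.Adj t v) :
    (T ⊔ G.subgraphOfAdj h).spanningCoe.IsAcyclic := by
  have hr : ¬ T.spanningCoe.Reachable t v := by
    rintro ⟨p⟩
    cases hp : p.reverse with
    | nil => exact G.irrefl h
    | cons hadj _ => exact hv (T.edge_vert (by simpa using hadj))
  rw [Subgraph.sup_spanningCoe, spanningCoe_subgraphOfAdj]
  exact (isAcyclic_add_edge_iff_of_not_reachable t v hr).2 hT

/-- Nontriviality gives `t` a neighbor in `T` already; with `v` it has two, so it is no longer an
end. For a one-vertex `T` this fails. -/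
theorem endVerts_sup_pendant_subset {T : G.Subgraph} (hT : T.Connected)
    (hn : T.verts.Nontrivial) {t v : V} (ht : t ∈ T.verts) (hv : v ∉ T.verts) (h : G.Adj t v) :
    (T ⊔ G.subgraphOfAdj h).endVerts ⊆ insert v (T.endVerts \ {t}) := by
  rintro w ⟨hw, hw1⟩
  by_cases hwv : w = v
  · exact Or.inl hwv
  rw [neighborSet_sup] at hw1
  have hwt : w ≠ t := by
    rintro rfl
    have := hn.coe_sort
    obtain ⟨u, hu⟩ := hT.preconnected.exists_adj_of_nontrivial ⟨w, ht⟩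
    rw [neighborSet_fst_subgraphOfAdj, Set.encard_eq_one] at hw1
    obtain ⟨x, hx⟩ := hw1
    have h1 : v = x := by
      have : v ∈ T.neighborSet w ∪ {v} := Or.inr rfl
      rwa [hx] at this
    have h2 : u = x := by
      have : u ∈ T.neighborSet w ∪ {v} := Or.inl hu
      rwa [hx] at this
    exact hv (h1.trans h2.symm ▸ T.edge_vert hu.symm)
  refine Or.inr ⟨?_, hwt⟩
  rw [neighborSet_subgraphOfAdj_of_ne_of_ne h hwt hwv, Set.union_empty] at hw1
  refine ⟨?_, hw1⟩
  simpa [hwt, hwv] using hw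

end Subgraph

/-- There is a subtree of `G` with vertex set `S`, all of whose end-vertices lie in `E`. -/
def HasTreeOn (G : SimpleGraph V) (S E : Set V) : Prop :=
  ∃ T : G.Subgraph, T.verts = S ∧ T.Connected ∧ T.spanningCoe.IsAcyclic ∧ T.endVerts ⊆ E

theorem hasTreeOn_singleton (v : V) : G.HasTreeOn {v} ∅ := by
  refine ⟨G.singletonSubgraph v, by simp, Subgraph.singletonSubgraph_connected, ?_, ?_⟩
  · have : (G.singletonSubgraph v).spanningCoe = ⊥ := by ext; simp
    rw [this]
    exact isAcyclic_bot
  · rintro w ⟨-, hw⟩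
    obtain ⟨x, hx⟩ := Set.encard_eq_one.1 hw
    have : x ∈ (G.singletonSubgraph v).neighborSet w := hx ▸ rfl
    simp at this

theorem hasTreeOn_pair {v w : V} (h : G.Adj v w) : G.HasTreeOn {v, w} {v, w} := by
  refine ⟨G.subgraphOfAdj h, by simp, Subgraph.subgraphOfAdj_connected h, ?_, fun x hx => ?_⟩
  · rw [Subgraph.spanningCoe_subgraphOfAdj, ← bot_sup_eq (fromEdgeSet _)]
    refine (isAcyclic_add_edge_iff_of_not_reachable v w ?_).2 isAcyclic_bot
    simpa using h.ne
  · simpa using hx.1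

theorem HasTreeOn.insert {S E : Set V} (hS : G.HasTreeOn S E) (hn : S.Nontrivial) {t v : V}
    (ht : t ∈ S) (hv : v ∉ S) (h : G.Adj t v) :
    G.HasTreeOn (insert v S) (insert v (E \ {t})) := by
  obtain ⟨T, rfl, hc, ha, hE⟩ := hS
  refine ⟨T ⊔ G.subgraphOfAdj h, ?_, ?_, Subgraph.isAcyclic_spanningCoe_sup_pendant ha hv h,
    (Subgraph.endVerts_sup_pendant_subset hc hn ht hv h).trans ?_⟩
  · ext x
    simp only [Subgraph.verts_sup, subgraphOfAdj_verts, Set.mem_union, Set.mem_insert_iff,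
      Set.mem_singleton_iff]
    grind
  · exact Subgraph.connected_sup hc.preconnected
      (Subgraph.subgraphOfAdj_connected h).preconnected ⟨t, by simpa using ht⟩
  · exact Set.insert_subset_insert (Set.sdiff_subset_sdiff_left hE)

/-- Prolonging a tree at a vertex of `E` is free: each new vertex replaces the previous one in `E`.
-/
theorem HasTreeOn.append_chain {Q : List V} {S E : Set V} {t : V} (hS : G.HasTreeOn S E)
    (hn : S.Nontrivial) (ht : t ∈ S) (htE : t ∈ E) (hQ : (t :: Q).IsChain G.Adj) (hd : Q.Nodup)
    (hQS : ∀ x ∈ Q, x ∉ S) :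
    ∃ E' : Set V, E'.encard ≤ E.encard ∧ G.HasTreeOn (S ∪ {x | x ∈ Q}) E' := by
  induction Q generalizing S E t with
  | nil => exact ⟨E, le_rfl, by simpa using hS⟩
  | cons a Q ih =>
    rw [List.isChain_cons_cons] at hQ
    rw [List.nodup_cons] at hd
    obtain ⟨E', hE', hT⟩ := ih (hS.insert hn ht (hQS a (by simp)) hQ.1)
      (hn.mono (Set.subset_insert _ _)) (Set.mem_insert _ _) (Set.mem_insert _ _) hQ.2 hd.2
      (fun x hx => by
        have := hQS x (by simp [hx])
        rw [Set.mem_insert_iff]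
        rintro (rfl | h)
        exacts [hd.1 hx, this h])
    refine ⟨E', hE'.trans ?_, ?_⟩
    · calc _ ≤ (E \ {t}).encard + 1 := Set.encard_insert_le _ _
        _ = E.encard := Set.encard_sdiff_singleton_add_one htE
    · convert hT using 1
      ext x
      simp only [Set.mem_union, Set.mem_ofPred_eq, List.mem_cons, Set.mem_insert_iff]
      tauto

/-- Here `t` need not be an end, so the first edge may cost one end; the rest of the chain is free.
-/
theorem HasTreeOn.attach_chain {Q : List V} {S E : Set V} {t a : V} (hS : G.HasTreeOn S E)
    (hn : S.Nontrivial) (ht : t ∈ S) (hta : G.Adj t a) (hQ : (a :: Q).IsChain G.Adj)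
    (hd : (a :: Q).Nodup) (hQS : ∀ x ∈ a :: Q, x ∉ S) :
    ∃ E' : Set V, E'.encard ≤ E.encard + 1 ∧ G.HasTreeOn (S ∪ {x | x ∈ a :: Q}) E' := by
  rw [List.nodup_cons] at hd
  obtain ⟨E', hE', hT⟩ := (hS.insert hn ht (hQS a (by simp)) hta).append_chain
    (hn.mono (Set.subset_insert _ _)) (Set.mem_insert _ _) (Set.mem_insert _ _) hQ hd.2
    (fun x hx => by
      have := hQS x (by simp [hx])
      rw [Set.mem_insert_iff]
      rintro (rfl | h)
      exacts [hd.1 hx, this h])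
  refine ⟨E', hE'.trans ?_, ?_⟩
  · exact (Set.encard_insert_le _ _).trans (by gcongr; exact Set.sdiff_subset)
  · convert hT using 1
    ext x
    simp only [Set.mem_union, Set.mem_ofPred_eq, List.mem_cons, Set.mem_insert_iff]
    tauto

theorem hasTreeOn_of_isChain {l : List V} (h0 : l ≠ []) (hl : l.IsChain G.Adj) (hd : l.Nodup) :
    ∃ E : Set V, E.encard ≤ 2 ∧ G.HasTreeOn {x | x ∈ l} E := by
  match l, h0, hl, hd with
  | [v], _, _, _ => exact ⟨∅, by simp, by simpa using hasTreeOn_singleton v⟩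
  | v :: w :: Q, _, hl, hd =>
    rw [List.isChain_cons_cons] at hl
    simp only [List.nodup_cons, List.mem_cons, not_or] at hd
    obtain ⟨E', hE', hT⟩ := (hasTreeOn_pair hl.1).append_chain (t := w)
      (Set.nontrivial_pair hl.1.ne) (by simp) (by simp) hl.2 hd.2.2 (fun x hx => by
        simp only [Set.mem_insert_iff, Set.mem_singleton_iff, not_or]
        exact ⟨fun e => hd.1.2 (e ▸ hx), fun e => hd.2.1 (e ▸ hx)⟩)
    refine ⟨E', hE'.trans (Set.encard_pair hl.1.ne).le, ?_⟩
    convert hT using 1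
    ext x
    simp [or_assoc]

/-- In a connected graph, a vertex set that misses an edge is adjacent to an end of an edge
that it misses. -/
theorem Connected.exists_adj_of_not_isIndepSet_compl (hG : G.Connected) {S : Set V}
    (hne : S.Nonempty) (hS : ¬ G.IsIndepSet Sᶜ) :
    ∃ t ∈ S, ∃ a ∉ S, ∃ b ∉ S, G.Adj t a ∧ G.Adj a b := by
  simp only [IsIndepSet, Set.Pairwise, not_forall, not_not] at hS
  obtain ⟨u, hu, w, hw, -, huw⟩ := hS
  obtain ⟨s, hs⟩ := hne
  obtain ⟨p⟩ := hG.preconnected u s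
  -- The invariant is that the edge `u w` avoids `S`. As long as the walk stays outside `S`, the
  -- edge just traversed takes its place; on entering `S`, the current edge is the one sought.
  induction p generalizing w with
  | nil => exact absurd hs hu
  | @cons u v s h p ih =>
    by_cases hv : v ∈ S
    · exact ⟨v, hv, u, hu, w, hw, h.symm, huw⟩
    · exact ih hv u hu h.symm hs

/-- Each round absorbs two outside vertices for at most one new end. The bound `2 * j + 1` is odd
because a single leftover vertex is already independent. -/
theorem HasTreeOn.exists_isDominating [Finite V] (hG : G.Connected) {S E : Set V}
    (hS : G.HasTreeOn S E) (hn : S.Nontrivial) (j : ℕ) (hj : Sᶜ.ncard ≤ 2 * j + 1) :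
    ∃ S' E' : Set V, E'.encard ≤ E.encard + j ∧ G.HasTreeOn S' E' ∧ G.IsIndepSet S'ᶜ := by
  induction j generalizing S E with
  | zero =>
    refine ⟨S, E, by simp, hS, ?_⟩
    have := Set.ncard_le_one_iff_subsingleton.1 (hj.trans (by simp))
    exact this.pairwise _
  | succ j ih =>
    by_cases hi : G.IsIndepSet Sᶜ
    · exact ⟨S, E, le_self_add, hS, hi⟩
    obtain ⟨t, ht, a, ha, b, hb, hta, hab⟩ :=
      hG.exists_adj_of_not_isIndepSet_compl hn.nonempty hi
    obtain ⟨E', hE', hT⟩ := hS.attach_chain (Q := [b]) hn ht hta (by simpa using hab)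
      (by simpa using hab.ne) (by simp [ha, hb])
    obtain ⟨S'', E'', hE'', h⟩ := ih hT (hn.mono Set.subset_union_left) (by
      have h1 : (S ∪ {x | x ∈ [a, b]})ᶜ ∪ {a, b} ⊆ Sᶜ := by
        rintro x (hx | rfl | rfl)
        exacts [fun h => hx (Or.inl h), ha, hb]
      have h2 := Set.ncard_le_ncard h1 (Set.toFinite _)
      rw [Set.ncard_union_eq, Set.ncard_pair hab.ne] at h2
      · omega
      · rw [Set.disjoint_right]
        rintro x (rfl | rfl) hx <;> exact hx (Or.inr (by simp)))
    refine ⟨S'', E'', hE''.trans ?_, h⟩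
    calc E'.encard + j ≤ E.encard + 1 + j := by gcongr
      _ = E.encard + (j + 1 : ℕ) := by push_cast; ring

theorem HasTreeOn.exists_isKEndedTree {S E : Set V} (hS : G.HasTreeOn S E) {k : ℕ}
    (hE : E.encard ≤ k) (hi : G.IsIndepSet Sᶜ) :
    ∃ T : G.Subgraph, T.IsKEndedTree k ∧ T.IsDominating := by
  obtain ⟨T, rfl, hc, ha, hTE⟩ := hS
  exact ⟨T, ⟨⟨hc, ha.embedding T.coeEmbeddingSpanningCoe⟩, (Set.encard_le_encard hTE).trans hE⟩, hi⟩

/-! ### Exchange arguments on a longest path -/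

/-- A list of distinct vertices, consecutive ones being adjacent. -/
def IsPathList (G : SimpleGraph V) (l : List V) : Prop :=
  l.IsChain G.Adj ∧ l.Nodup

theorem IsPathList.reverse {l : List V} (h : G.IsPathList l) : G.IsPathList l.reverse :=
  ⟨List.isChain_reverse.2 (h.1.imp fun _ _ h => h.symm), List.nodup_reverse.2 h.2⟩

theorem exists_max_length [Fintype V] (p : List V → Prop) (hp : ∃ l, p l)
    (hd : ∀ l, p l → l.Nodup) : ∃ l, p l ∧ ∀ l', p l' → l'.length ≤ l.length := by
  obtain ⟨l, hl, hmin⟩ := (measure fun l : List V => Fintype.card V - l.length).wf.has_min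
    {l | p l} hp
  refine ⟨l, hl, fun l' hl' => ?_⟩
  have h1 : ¬ (Fintype.card V - l'.length < Fintype.card V - l.length) := hmin l' hl'
  have h2 := (hd l' hl').length_le_card
  omega

/-- A path list of maximum length, with ends `x` and `y`. -/
structure IsLongestPathList (G : SimpleGraph V) (l : List V) (x y : V) : Prop where
  isPathList : G.IsPathList l
  length_le : ∀ l', G.IsPathList l' → l'.length ≤ l.length
  head_eq : l.head? = some x
  last_eq : l.getLast? = some y

namespace IsLongestPathList

variable {l : List V} {x y : V}

theorem reverse (h : G.IsLongestPathList l x y) : G.IsLongestPathList l.reverse y x :=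
  ⟨h.1.reverse, by simpa using h.2, by simpa using h.4, by simpa using h.3⟩

theorem head_mem (h : G.IsLongestPathList l x y) : x ∈ l := List.mem_of_head? h.head_eq

theorem last_mem (h : G.IsLongestPathList l x y) : y ∈ l := List.mem_of_getLast? h.last_eq

theorem mem_of_adj_head (h : G.IsLongestPathList l x y) {q : V} (hq : G.Adj q x) : q ∈ l := by
  by_contra hql
  have := h.length_le (q :: l) ⟨List.isChain_cons.2 ⟨fun z hz => ?_, h.1.1⟩,
    List.nodup_cons.2 ⟨hql, h.1.2⟩⟩
  · simp at this
  · rw [h.head_eq] at hz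
    cases hz
    exact hq

theorem mem_of_adj_last (h : G.IsLongestPathList l x y) {q : V} (hq : G.Adj q y) : q ∈ l := by
  simpa using h.reverse.mem_of_adj_head hq

/-- Otherwise the path from `q` to `u`, back along `A` to `x`, across to `w` and on through `B`
would be longer than `l`. -/
theorem mem_of_adj_left (h : G.IsLongestPathList l x y) {A B : List V} {u w q : V}
    (hl : l = A ++ u :: w :: B) (hw : G.Adj x w) (hq : G.Adj q u) : q ∈ l := by
  by_contra hql
  obtain ⟨⟨hc, hd⟩, hmax, hh, -⟩ := h
  have hlen := hmax (q :: u :: (A.reverse ++ w :: B)) ⟨?_, ?_⟩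
  · simp [hl] at hlen
    omega
  · rw [hl, List.isChain_append_cons_cons] at hc
    have h1 : (u :: A.reverse).IsChain G.Adj := by
      have : (A ++ [u]).reverse.IsChain G.Adj :=
        List.isChain_reverse.2 (hc.1.imp fun _ _ h => h.symm)
      simpa using this
    rw [List.isChain_cons_cons]
    refine ⟨hq, ?_⟩
    rw [← List.cons_append]
    refine List.IsChain.append h1 hc.2.2 fun z hz z' hz' => ?_
    have hx : z = x := by
      have h2 : (A ++ u :: w :: B).head? = (u :: A.reverse).getLast? := by
        rw [← List.head?_reverse]
        cases A <;> simp
      rw [hl, h2, hz] at hh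
      simpa using hh
    have : z' = w := by simpa using hz'.symm
    rwa [hx, this]
  · have hp : (q :: u :: (A.reverse ++ w :: B)).Perm (q :: l) := by
      rw [hl]
      refine List.Perm.cons _ ?_
      calc (u :: (A.reverse ++ w :: B)).Perm (u :: (A ++ w :: B)) :=
            ((List.reverse_perm A).append_right _).cons _
        _ |>.Perm (A ++ u :: w :: B) := List.perm_middle.symm
    exact hp.nodup_iff.2 (List.nodup_cons.2 ⟨hql, hd⟩)

theorem mem_of_adj_right (h : G.IsLongestPathList l x y) {A B : List V} {u w q : V}
    (hl : l = A ++ u :: w :: B) (hu : G.Adj y u) (hq : G.Adj q w) : q ∈ l := by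
  have := h.reverse.mem_of_adj_left (A := B.reverse) (B := A.reverse) (u := w) (w := u)
    (by simp [hl]) hu hq
  simpa using this

/-- A closed path list with an edge attached to it can be cut open at the attachment. -/
theorem length_add_two_le_of_cycle (h : G.IsLongestPathList l x y) {c : List V} {s t v a b : V}
    (hc : G.IsPathList c) (hs : c.head? = some s) (ht : c.getLast? = some t) (hts : G.Adj t s)
    (hv : v ∈ c) (ha : a ∉ c) (hb : b ∉ c) (hav : G.Adj a v) (hab : G.Adj a b) :
    c.length + 2 ≤ l.length := by
  obtain ⟨A, B, rfl⟩ := List.append_of_mem hv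
  have hlen := h.length_le (b :: a :: ((v :: B) ++ A)) ⟨?_, ?_⟩
  · simp at hlen ⊢
    omega
  · have h1 := List.isChain_append.1 hc.1
    rw [List.isChain_cons_cons]
    refine ⟨hab.symm, List.isChain_cons.2 ⟨by simpa using hav, ?_⟩⟩
    refine h1.2.1.append h1.1 fun z hz z' hz' => ?_
    have h2 : z = t := by
      rw [List.getLast?_append_of_ne_nil _ (by simp)] at ht
      rw [ht] at hz
      simpa using hz.symm
    have h3 : z' = s := by
      cases A with
      | nil => simp at hz'
      | cons => simp_all
    rwa [h2, h3]
  · have hp : ((v :: B) ++ A).Perm (A ++ v :: B) := List.perm_append_comm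
    rw [List.nodup_cons, List.nodup_cons, hp.nodup_iff]
    refine ⟨?_, by rwa [hp.mem_iff], hc.2⟩
    rw [List.mem_cons, hp.mem_iff, not_or]
    exact ⟨hab.ne', hb⟩

theorem not_adj_ends (h : G.IsLongestPathList l x y) {v a b : V} (hv : v ∈ l) (ha : a ∉ l)
    (hb : b ∉ l) (hav : G.Adj a v) (hab : G.Adj a b) : ¬ G.Adj x y := fun hxy => by
  have := h.length_add_two_le_of_cycle h.isPathList h.head_eq h.last_eq hxy.symm hv ha hb hav hab
  omega

/-- Omitting `m`, the rest of `l` closes up to a cycle: from `x` to `u`, across to `y`, back to `w`,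
across to `x`. Cutting it at `v` and adding `a`, `b` gives a path with one vertex more than `l`. -/
theorem false_of_adj_crossing (h : G.IsLongestPathList l x y) {v a b : V} (hv : v ∈ l)
    (ha : a ∉ l) (hb : b ∉ l) (hav : G.Adj a v) (hab : G.Adj a b) {A B : List V} {u m w : V}
    (hl : l = A ++ u :: m :: w :: B) (hw : G.Adj x w) (hu : G.Adj y u) : False := by
  -- The attachment vertex survives on the cycle: `m` precedes a neighbor of `x`, so no vertex off
  -- `l` is adjacent to it.
  have hvm : v ≠ m := by
    rintro rfl
    exact ha (h.mem_of_adj_left (A := A ++ [u]) (B := B) (by simp [hl]) hw hav)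
  obtain ⟨hc, hd⟩ := h.isPathList
  have hh := h.head_eq
  have ht := h.last_eq
  have hp : ((A ++ [u]) ++ (w :: B).reverse).Perm (A ++ u :: w :: B) := by
    rw [List.append_assoc]
    exact ((List.reverse_perm _).append_left _).append_left _
  have hmem : ∀ z, z ∈ l ↔ z = m ∨ z ∈ A ++ u :: w :: B := by
    intro z
    simp only [hl, List.mem_append, List.mem_cons]
    tauto
  have := h.length_add_two_le_of_cycle (c := (A ++ [u]) ++ (w :: B).reverse) (s := x) (t := w)
    (v := v) (a := a) (b := b) ⟨?_, ?_⟩ ?_ ?_ hw.symm ?_ ?_ ?_ hav hab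
  · simp [hl] at this
    omega
  · rw [hl, List.isChain_append_cons_cons, List.isChain_cons_cons] at hc
    refine hc.1.append (List.isChain_reverse.2 (hc.2.2.2.imp fun _ _ h => h.symm)) ?_
    intro z hz z' hz'
    have h1 : z = u := by simpa using hz.symm
    have h2 : z' = y := by
      have : l.getLast? = (w :: B).getLast? := by
        rw [hl, List.getLast?_append_of_ne_nil _ (by simp)]
        simp
      rw [List.head?_reverse, ← this, ht] at hz'
      simpa using hz'.symm
    rw [h1, h2]
    exact hu.symm
  · rw [hp.nodup_iff]
    refine hd.sublist ?_
    rw [hl]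
    exact List.Sublist.append_left ((List.sublist_cons_self _ _).cons_cons _) _
  · rw [← hh, hl]
    cases A <;> simp
  · rw [List.getLast?_append_of_ne_nil _ (by simp)]
    simp
  · rw [hp.mem_iff]
    exact ((hmem v).1 hv).resolve_left hvm
  · rw [hp.mem_iff]
    exact fun h => ha ((hmem a).2 (Or.inr h))
  · rw [hp.mem_iff]
    exact fun h => hb ((hmem b).2 (Or.inr h))

end IsLongestPathList

/-! ### Counting degrees by positions on a longest path -/

theorem exists_eq_append_cons_cons {l : List V} {i : ℕ} {u w : V} (hu : l[i]? = some u)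
    (hw : l[i + 1]? = some w) : ∃ A B, l = A ++ u :: w :: B := by
  obtain ⟨hi, rfl⟩ := List.getElem?_eq_some_iff.1 hu
  obtain ⟨hj, rfl⟩ := List.getElem?_eq_some_iff.1 hw
  exact ⟨l.take i, l.drop (i + 2), by simp⟩

theorem exists_eq_append_cons_cons_cons {l : List V} {i : ℕ} {u w : V} (hu : l[i]? = some u)
    (hw : l[i + 2]? = some w) : ∃ A B m, l = A ++ u :: m :: w :: B := by
  obtain ⟨hi, rfl⟩ := List.getElem?_eq_some_iff.1 hu
  obtain ⟨hj, rfl⟩ := List.getElem?_eq_some_iff.1 hw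
  exact ⟨l.take i, l.drop (i + 3), l[i + 1], by simp⟩

open Classical in
-- Count positions on `l`: `I` shifts the neighbors of `x` down by one, `J` shifts those of `y` up
-- by one, and `K` keeps those of `q` in place. A common position of `I` and `J` is a crossing; one
-- of `K` with either would let `q` be inserted into a longer path. The edge `ab` serves only to
-- exclude crossings.
theorem IsLongestPathList.degree_add_degree_add_card_le [Fintype V] [DecidableRel G.Adj]
    {l : List V} {x y : V}
    (h : G.IsLongestPathList l x y) {v a b : V} (hv : v ∈ l) (ha : a ∉ l) (hb : b ∉ l)
    (hav : G.Adj a v) (hab : G.Adj a b) {q : V} (hq : q ∉ l) :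
    G.degree x + G.degree y + {z ∈ G.neighborFinset q | z ∈ l}.card ≤ l.length := by
  obtain ⟨I, hI⟩ : ∃ I : Finset ℕ, ∀ j, j ∈ I ↔ j < l.length ∧
      ∃ z, l[j + 1]? = some z ∧ G.Adj x z :=
    ⟨{j ∈ Finset.range l.length | ∃ z, l[j + 1]? = some z ∧ G.Adj x z},
      fun j => by simp⟩
  obtain ⟨J, hJ⟩ : ∃ J : Finset ℕ, ∀ j, j ∈ J ↔ j < l.length ∧
      ∃ i z, j = i + 1 ∧ l[i]? = some z ∧ G.Adj y z :=
    ⟨{j ∈ Finset.range l.length | ∃ i z, j = i + 1 ∧ l[i]? = some z ∧ G.Adj y z},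
      fun j => by simp⟩
  obtain ⟨K, hK⟩ : ∃ K : Finset ℕ, ∀ j, j ∈ K ↔ j < l.length ∧
      ∃ z, l[j]? = some z ∧ G.Adj q z :=
    ⟨{j ∈ Finset.range l.length | ∃ z, l[j]? = some z ∧ G.Adj q z},
      fun j => by simp⟩
  have hx : G.degree x ≤ I.card := by
    -- The default `x` is never reached, since position `j + 1` exists for every `j` in `I`.
    refine (Finset.card_le_card (t := I.image fun j => (l[j + 1]?).getD x) fun z hz => ?_).trans
      Finset.card_image_le
    rw [mem_neighborFinset] at hz
    obtain ⟨i, hi⟩ := List.mem_iff_getElem?.1 (h.mem_of_adj_head hz.symm)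
    rcases i with - | i
    · rw [← List.head?_eq_getElem?, h.head_eq] at hi
      exact absurd (Option.some_injective _ hi) hz.ne
    · have := (List.getElem?_eq_some_iff.1 hi).1
      refine Finset.mem_image.2 ⟨i, ?_, by simp [hi]⟩
      exact (hI _).2 ⟨by omega, z, hi, hz⟩
  have hy : G.degree y ≤ J.card := by
    refine (Finset.card_le_card (t := J.image fun j => (l[j - 1]?).getD y) fun z hz => ?_).trans
      Finset.card_image_le
    rw [mem_neighborFinset] at hz
    obtain ⟨i, hi⟩ := List.mem_iff_getElem?.1 (h.mem_of_adj_last hz.symm)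
    have h1 := (List.getElem?_eq_some_iff.1 hi).1
    have h2 : i ≠ l.length - 1 := by
      rintro rfl
      rw [← List.getLast?_eq_getElem?, h.last_eq] at hi
      exact hz.ne (Option.some_injective _ hi)
    refine Finset.mem_image.2 ⟨i + 1, ?_, by simp [hi]⟩
    exact (hJ _).2 ⟨by omega, i, z, rfl, hi, hz⟩
  have hqK : {z ∈ G.neighborFinset q | z ∈ l}.card ≤ K.card := by
    refine (Finset.card_le_card (t := K.image fun j => (l[j]?).getD y) fun z hz => ?_).trans
      Finset.card_image_le
    rw [Finset.mem_filter, mem_neighborFinset] at hz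
    obtain ⟨i, hi⟩ := List.mem_iff_getElem?.1 hz.2
    refine Finset.mem_image.2 ⟨i, ?_, by simp [hi]⟩
    exact (hK _).2 ⟨(List.getElem?_eq_some_iff.1 hi).1, z, hi, hz.1⟩
  have hIJ : Disjoint I J := by
    rw [Finset.disjoint_left]
    intro j hj hj'
    obtain ⟨w, hw, hxw⟩ := ((hI _).1 hj).2
    obtain ⟨i, u, rfl, hu, hyu⟩ := ((hJ _).1 hj').2
    obtain ⟨A, B, m, hl⟩ := exists_eq_append_cons_cons_cons hu hw
    exact h.false_of_adj_crossing hv ha hb hav hab hl hxw hyu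
  have hIJK : Disjoint (I ∪ J) K := by
    rw [Finset.disjoint_union_left]
    refine ⟨Finset.disjoint_left.2 fun j hj hj' => ?_, Finset.disjoint_left.2 fun j hj hj' => ?_⟩
    · obtain ⟨w, hw, hxw⟩ := ((hI _).1 hj).2
      obtain ⟨u, hu, hqu⟩ := ((hK _).1 hj').2
      obtain ⟨A, B, hl⟩ := exists_eq_append_cons_cons hu hw
      exact hq (h.mem_of_adj_left hl hxw hqu)
    · obtain ⟨i, u, rfl, hu, hyu⟩ := ((hJ _).1 hj).2
      obtain ⟨w, hw, hqw⟩ := ((hK _).1 hj').2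
      obtain ⟨A, B, hl⟩ := exists_eq_append_cons_cons hu hw
      exact hq (h.mem_of_adj_right hl hyu hqw)
  have hsub : I ∪ J ∪ K ⊆ Finset.range l.length :=
    Finset.union_subset (Finset.union_subset
      (fun j hj => Finset.mem_range.2 ((hI j).1 hj).1)
      (fun j hj => Finset.mem_range.2 ((hJ j).1 hj).1))
      (fun j hj => Finset.mem_range.2 ((hK j).1 hj).1)
  have := Finset.card_le_card hsub
  rw [Finset.card_union_of_disjoint hIJK, Finset.card_union_of_disjoint hIJ,
    Finset.card_range] at this
  omega

theorem exists_isLongestPathList [Fintype V] [Nonempty V] (G : SimpleGraph V) :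
    ∃ l x y, G.IsLongestPathList l x y := by
  obtain ⟨l, hl, hmax⟩ := exists_max_length G.IsPathList ⟨[], by simp [IsPathList]⟩
    fun l hl => hl.2
  have hne : l ≠ [] := by
    rintro rfl
    simpa using hmax [Classical.arbitrary V] (by simp [IsPathList])
  exact ⟨l, l.head hne, l.getLast hne, hl, hmax, List.head?_eq_some_head hne,
    List.getLast?_eq_some_getLast hne⟩

theorem minDegreeSum_three_le [Fintype V] [DecidableRel G.Adj] {x y z : V} (hxy : x ≠ y)
    (hxz : x ≠ z) (hyz : y ≠ z) (h1 : ¬ G.Adj x y) (h2 : ¬ G.Adj x z) (h3 : ¬ G.Adj y z) :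
    G.minDegreeSum 3 ≤ ((G.degree x + G.degree y + G.degree z : ℕ) : ℕ∞) := by
  classical
  have hS : G.IsNIndepSet 3 {x, y, z} := by
    refine ⟨?_, Finset.card_eq_three.2 ⟨x, y, z, hxy, hxz, hyz, rfl⟩⟩
    intro u hu w hw _
    simp only [Finset.coe_insert, Finset.coe_singleton, Set.mem_insert_iff,
      Set.mem_singleton_iff] at hu hw
    rcases hu with rfl | rfl | rfl <;> rcases hw with rfl | rfl | rfl <;>
      simp_all [G.adj_comm]
  refine (iInf₂_le _ hS).trans_eq ?_
  rw [Finset.sum_insert (by simp [hxy, hxz]), Finset.sum_insert (by simp [hyz]),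
    Finset.sum_singleton, add_assoc]

/-- A path list outside `l` that starts at `a` and cannot be made longer ends at a vertex
all of whose neighbors lie on `l` or on the list. -/
theorem exists_maximal_isPathList_disjoint [Fintype V] (G : SimpleGraph V) {l : List V} {a : V}
    (ha : a ∉ l) : ∃ Q q, G.IsPathList (a :: Q) ∧ (∀ z ∈ a :: Q, z ∉ l) ∧ q ∈ a :: Q ∧
      ∀ z, G.Adj q z → z ∈ l ∨ z ∈ a :: Q := by
  obtain ⟨Q', ⟨hQ, Q, rfl, hQl⟩, hmax⟩ := exists_max_length
    (fun R => G.IsPathList R ∧ ∃ Q, R = a :: Q ∧ ∀ z ∈ R, z ∉ l)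
    ⟨[a], by simp [IsPathList], [], rfl, by simpa using ha⟩ fun l hl => hl.1.2
  refine ⟨Q, (a :: Q).getLast (by simp), hQ, hQl, List.getLast_mem _, fun z hz => ?_⟩
  by_contra! hzn
  have := hmax ((a :: Q) ++ [z]) ⟨⟨hQ.1.append (by simp) ?_, ?_⟩, Q ++ [z], rfl, ?_⟩
  · simp at this
  · intro u hu w hw
    rw [List.getLast?_eq_some_getLast (by simp)] at hu
    cases hu
    cases hw
    exact hz
  · have hp : ((a :: Q) ++ [z]).Perm (z :: a :: Q) := List.perm_append_singleton _ _
    exact hp.nodup_iff.2 (List.nodup_cons.2 ⟨hzn.2, hQ.2⟩)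
  · intro w hw
    rcases List.mem_append.1 hw with hw | hw
    · exact hQl w hw
    · rw [List.mem_singleton.1 hw]
      exact hzn.1

end SimpleGraph

/-! ### Assembling the dominating tree -/

open SimpleGraph in
/-- The inequality `σ₃ ≥ n - 2k + 4` is written without subtraction, as `n + 4 ≤ σ₃ + 2k`. -/
theorem corollary1 {V : Type*} [Fintype V] (G : SimpleGraph V) [DecidableRel G.Adj]
    (k : ℕ) (hk : 2 ≤ k) (hG : G.Connected)
    (hσ : (Fintype.card V : ℕ∞) + 4 ≤ G.minDegreeSum 3 + 2 * (k : ℕ∞)) :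
    ∃ T : G.Subgraph, T.IsKEndedTree k ∧ T.IsDominating := by
  classical
  have := hG.nonempty
  obtain ⟨l, x, y, h⟩ := exists_isLongestPathList G
  obtain ⟨E, hE, hT⟩ := hasTreeOn_of_isChain (List.ne_nil_of_mem h.head_mem)
    h.isPathList.1 h.isPathList.2
  by_cases hi : G.IsIndepSet {z | z ∈ l}ᶜ
  · exact hT.exists_isKEndedTree (hE.trans (by exact_mod_cast hk)) hi
  obtain ⟨t, ht, a, ha, b, hb, hta, hab⟩ :=
    hG.exists_adj_of_not_isIndepSet_compl ⟨x, h.head_mem⟩ hi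
  rw [Set.mem_ofPred_eq] at ht ha hb
  obtain ⟨Q, q, hQ, hQl, hqQ, hqn⟩ := G.exists_maximal_isPathList_disjoint ha
  have hq := hQl q hqQ
  have hxy : x ≠ y := by
    rintro rfl
    -- The path `b, a, t` shows that `l` has more than one vertex, so equal ends would repeat a
    -- vertex.
    have hlen := h.length_le [b, a, t] ⟨by simp [hab.symm, hta.symm], by
      simp [hab.ne', hta.ne', ne_of_mem_of_not_mem ht hb |>.symm]⟩
    obtain ⟨hd, hh, hl⟩ := And.intro h.isPathList.2 (And.intro h.head_eq h.last_eq)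
    match l, hh, hl, hlen, hd with
    | c :: d :: l, hh, hl, _, hd =>
      have h1 : c = x := by simpa using hh
      subst h1
      rw [List.getLast?_cons_cons] at hl
      exact (List.nodup_cons.1 hd).1 (List.mem_of_getLast? hl)
  have hln : ({z | z ∈ l} : Set V).Nontrivial := ⟨x, h.head_mem, y, h.last_mem, hxy⟩
  have hdeg := h.degree_add_degree_add_card_le ht ha hb hta.symm hab hq
  have hσ' := minDegreeSum_three_le hxy (ne_of_mem_of_not_mem h.head_mem hq)
    (ne_of_mem_of_not_mem h.last_mem hq) (h.not_adj_ends ht ha hb hta.symm hab)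
    (fun hn => hq (h.mem_of_adj_head hn.symm)) (fun hn => hq (h.mem_of_adj_last hn.symm))
  have hsum : Fintype.card V + 4 ≤ G.degree x + G.degree y + G.degree q + 2 * k := by
    have := hσ.trans (add_le_add_left hσ' _)
    exact_mod_cast this
  -- The `+ 1` is `q` itself, which lies on `a :: Q` but is not its own neighbor.
  have hqd : G.degree q + 1 ≤ {z ∈ G.neighborFinset q | z ∈ l}.card + (a :: Q).length := by
    have h1 : G.neighborFinset q ⊆
        {z ∈ G.neighborFinset q | z ∈ l} ∪ (a :: Q).toFinset.erase q := fun z hz => by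
      have hz' := (G.mem_neighborFinset q z).1 hz
      rw [Finset.mem_union, Finset.mem_filter, Finset.mem_erase, List.mem_toFinset]
      exact (hqn z hz').imp (fun h => ⟨hz, h⟩) (fun h => ⟨hz'.ne', h⟩)
    have h2 := (Finset.card_le_card h1).trans (Finset.card_union_le _ _)
    rw [card_neighborFinset_eq_degree] at h2
    have h3 := Finset.card_erase_add_one (List.mem_toFinset.2 hqQ)
    rw [List.toFinset_card_of_nodup hQ.2] at h3
    omega
  obtain ⟨E', hE', hT'⟩ := hT.attach_chain hln ht hta hQ.1 hQ.2 hQl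
  have hcard : ({z | z ∈ l} ∪ {z | z ∈ a :: Q} : Set V)ᶜ.ncard + l.length + (a :: Q).length =
      Fintype.card V := by
    have hs : ({z | z ∈ l} ∪ {z | z ∈ a :: Q} : Set V) = ((l ++ a :: Q).toFinset : Set V) := by
      ext z
      simp only [Set.mem_union, Set.mem_ofPred_eq, List.coe_toFinset, List.mem_append]
    have hnd : (l ++ a :: Q).Nodup :=
      List.Nodup.append h.isPathList.2 hQ.2 fun z hz hz' => hQl z hz' hz
    have := Set.ncard_add_ncard_compl ((l ++ a :: Q).toFinset : Set V)
    rw [Set.ncard_coe_finset, List.toFinset_card_of_nodup hnd, List.length_append,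
      Nat.card_eq_fintype_card] at this
    rw [hs]
    omega
  -- The degree bounds leave at most `2k - 5 = 2(k - 3) + 1` vertices outside. This also forces `k ≥
  -- 3`, so the subtraction is not truncated.
  obtain ⟨S, E'', hE'', hS, hSi⟩ := hT'.exists_isDominating hG
    (hln.mono Set.subset_union_left) (k - 3) (by omega)
  refine hS.exists_isKEndedTree (hE''.trans ?_) hSi
  calc E'.encard + (k - 3 : ℕ) ≤ 2 + 1 + (k - 3 : ℕ) := by gcongr; exact hE'.trans (by gcongr)
    _ = ((3 + (k - 3) : ℕ) : ℕ∞) := by push_cast; norm_num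
    _ = k := by rw [Nat.add_sub_cancel' (by omega)]
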